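/- Let $\mathcal L_2^n$ be the space of square-integrable signals $[0,\infty)\to\mathbb R^n$ (modulo a.e. equality) with norm $\|\cdot\|$, and let $\mathcal L_{2e}^n$ be the space of signals all of whose truncations $\Gamma_T u$ ($\Gamma_Tu=u$ on $[0,T]$, $0$ afterwards, $T\ge 0$) lie in $\mathcal L_2^n$. An operator $H$ on $\mathcal L_{2e}$ is causal if $\Gamma_THu=\Gamma_TH\Gamma_Tu$ for all $T\ge0$ and all $u$; its incremental gain is $\|H\|_\Delta=\sup\{\|Hu-Hv\|/\|u-v\| : u,v\in\mathcal L_2,\ u\ne v\}\in[0,\infty]$, and it is bounded if $\|H\|_\Delta<\infty$. The frequency response of a bounded causal linear time-invariant (LTI) system $H$ is the bounded matrix function $\omega\mapsto H(j\omega)$ with $\widehat{Hu}(j\omega)=H(j\omega)\hat u(j\omega)$ for almost every $\omega$, for all $u\in\mathcal L_2$. Let $H_1:\mathcal L_{2e}^n\to\mathcal L_{2e}^n$ be a bounded causal LTI system with frequency response $H_1(j\omega)$, and let $H_2:\mathcal L_{2e}^n\to\mathcal L_{2e}^n$ be causal with $H_20=0$ and finite gain on $\mathcal L_2^n$, that is,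 $\sup_{0\ne u\in\mathcal L_2^n}\|H_2u\|/\|u\|<\infty$. Let $M=M^\top\in\mathbb R^{m\times m}$ and let $N$ be a bounded causal LTI system with $2n$ inputs, $m$ outputs and frequency response $N(j\omega)$. For $\mu\in(0,1]$ consider the interconnection of $H_1$ and $\mu H_2$, $$u_1=w+y_2,\quad u_2=y_1,\quad y_1=H_1u_1,\quad y_2=\mu H_2u_2 .$$ Suppose that for every $\mu\in(0,1]$: (a) the interconnection is well-posed: the map $u_1\mapsto w=u_1-\mu H_2H_1u_1$ has a causal inverse on $\mathcal L_{2e}^n$; (b) $\mu H_2$ satisfies the soft incremental IQC with multipliers $(M,N)$: for all $u,u'\in\mathcal L_2^n$ with $y=\mu H_2u\in\mathcal L_2^n$ and $y'=\mu H_2u'\in\mathcal L_2^n$, $$\int_0^\infty g(t)^\top M g(t)\,dt\ge 0,\qquad g=N\begin{bmatrix}u-u'\\y-y'\end{bmatrix}.$$ Let $\mathbf\Pi(M,N)$ be the set of all symmetric $\Pi\in\mathbb R^{2\times2}$ for which there is $\tau>0$ such that for all $\omega\in\mathbb R$ $$\begin{bmatrix}I\\N(j\omega)\end{bmatrix}^*\begin{bmatrix}\Pi\otimes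 I&0\\0&-\tau M\end{bmatrix}\begin{bmatrix}I\\N(j\omega)\end{bmatrix}\succeq0,$$ and let $$\mathcal C(M,N)=\bigcap_{\Pi\in\mathbf\Pi(M,N)}\left\{z\in\mathbb C:\begin{bmatrix}z\\1\end{bmatrix}^*\Pi\begin{bmatrix}z\\1\end{bmatrix}\ge0\right\}.$$ For $A\in\mathbb C^{n\times n}$ let $\mathrm{SRG}(A)=\{\rho e^{\pm j\theta}: 0\ne u\in\mathbb C^n\}$, where $\rho=\|Au\|/\|u\|$ and $\theta=\arccos\frac{\operatorname{Re}\langle u,Au\rangle}{\|u\|\|Au\|}$ ($\theta=0$ if $Au=0$). Suppose there is $r>0$ such that for all $\mu\in(0,1]$ and all $\omega\in\mathbb R$ $$\operatorname{dist}\bigl(\mathrm{SRG}(H_1(j\omega)),\,\mu\,\mathcal C(M,N)\bigr)\ge r ,$$ where $\operatorname{dist}(S_1,S_2)=\inf_{a\in S_1,\,b\in S_2}|a-b|$ and $\inf\emptyset=\infty$. Then the closed-loop map $T:w\mapsto y_1$ of the interconnection of $H_1$ and $H_2$ (the case $\mu=1$) satisfies $\|T\|_\Delta<\infty$. -/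

import Mathlib

open MeasureTheory Set
open scoped ENNReal Matrix Kronecker Pointwise FourierTransform ComplexOrder

noncomputable section

namespace Lure

/-! ### Signals -/

/-- Lebesgue measure on the time axis `[0, ∞)`. -/
abbrev timeMeasure : Measure ℝ := volume.restrict (Ici 0)

/-- Measurable signals `[0, ∞) → ℝ^ι`, identified when they agree almost everywhere. -/
abbrev Signal (ι : Type) [Fintype ι] : Type := ℝ →ₘ[timeMeasure] EuclideanSpace ℝ ι

/-- The truncation `Γ_T u`: equal to `u` on `[0, T]` and to `0` on `(T, ∞)`. -/
def truncSignal {ι : Type} [Fintype ι] (T : ℝ) (u : Signal ι) : Signal ι :=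
  AEEqFun.mk ((Iic T).indicator u) (u.aestronglyMeasurable.indicator measurableSet_Iic)

/-- Truncated signals are square integrable iff the indicator of the signal is. -/
theorem memLp_truncSignal {ι : Type} [Fintype ι] (T : ℝ) (u : Signal ι) :
    MemLp (truncSignal T u) 2 timeMeasure ↔ MemLp ((Iic T).indicator u) 2 timeMeasure :=
  memLp_congr_ae (AEEqFun.coeFn_mk _ _)

/-- The extended space `L_{2e}`: signals all of whose truncations are square integrable. -/
def L2e (ι : Type) [Fintype ι] : Submodule ℝ (Signal ι) where
  carrier := {u | ∀ T : ℝ, 0 ≤ T → MemLp (truncSignal T u) 2 timeMeasure}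
  zero_mem' := by
    intro T _
    rw [memLp_truncSignal]
    refine MemLp.indicator measurableSet_Iic ?_
    exact (memLp_congr_ae AEEqFun.coeFn_zero).2 MemLp.zero
  add_mem' := by
    intro u v hu hv T hT
    rw [memLp_truncSignal]
    have h := ((memLp_truncSignal T u).1 (hu T hT)).add ((memLp_truncSignal T v).1 (hv T hT))
    refine (memLp_congr_ae ?_).1 h
    filter_upwards [AEEqFun.coeFn_add u v] with t ht
    by_cases h : t ∈ Iic T <;> simp [h, ht]
  smul_mem' := by
    intro c u hu T hT
    rw [memLp_truncSignal]
    have h := ((memLp_truncSignal T u).1 (hu T hT)).const_smul c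
    refine (memLp_congr_ae ?_).1 h
    filter_upwards [AEEqFun.coeFn_smul c u] with t ht
    by_cases h : t ∈ Iic T <;> simp [h, ht]

/-- Membership of a signal in `L_2`. -/
def InL2 {ι : Type} [Fintype ι] (u : L2e ι) : Prop := MemLp u.val 2 timeMeasure

/-- The `L_2` norm of a signal, with value `∞` if the signal is not in `L_2`. -/
def l2norm {ι : Type} [Fintype ι] (u : L2e ι) : ℝ≥0∞ := eLpNorm u.val 2 timeMeasure

/-- The truncation operator `Γ_T` on `L_{2e}`. -/
def trunc {ι : Type} [Fintype ι] (T : ℝ) (u : L2e ι) : L2e ι :=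
  ⟨truncSignal T (u : Signal ι), by
    intro S hS
    rw [memLp_truncSignal]
    have h := (memLp_truncSignal S (u : Signal ι)).1 (u.2 S hS)
    refine (memLp_congr_ae ?_).1 (h.indicator (measurableSet_Iic (a := T)))
    filter_upwards [AEEqFun.coeFn_mk ((Iic T).indicator (u : Signal ι))
      ((u : Signal ι).aestronglyMeasurable.indicator measurableSet_Iic)] with t ht
    by_cases h1 : t ∈ Iic T <;> by_cases h2 : t ∈ Iic S <;> simp_all [truncSignal]⟩

/-- The continuous linear map placing a vector in block `k` of a two-block vector. -/
def blockCLM {ι : Type} [Fintype ι] (k : Fin 2) :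
    EuclideanSpace ℝ ι →L[ℝ] EuclideanSpace ℝ (Fin 2 × ι) :=
  LinearMap.toContinuousLinearMap
    { toFun := fun x => WithLp.toLp 2 fun p => if p.1 = k then x p.2 else 0
      map_add' := by
        intro x y
        ext p
        by_cases h : p.1 = k <;> simp [h]
      map_smul' := by
        intro c x
        ext p
        by_cases h : p.1 = k <;> simp [h] }

/-- The signal with `u` in block `k` and `0` in the other block. -/
def block {ι : Type} [Fintype ι] (k : Fin 2) (u : L2e ι) : L2e (Fin 2 × ι) :=
  ⟨AEEqFun.comp (blockCLM k) (blockCLM k).continuous (u : Signal ι), by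
    intro T hT
    rw [memLp_truncSignal]
    have h := (blockCLM (ι := ι) k).comp_memLp'
      ((memLp_truncSignal T (u : Signal ι)).1 (u.2 T hT))
    refine (memLp_congr_ae ?_).1 h
    filter_upwards [AEEqFun.coeFn_comp (blockCLM (ι := ι) k) (blockCLM k).continuous
      (u : Signal ι)] with t ht
    by_cases h : t ∈ Iic T <;> simp [h, ht]⟩

/-- The stacked signal `[u; y]`: block `0` is `u` and block `1` is `y`. -/
def stack {ι : Type} [Fintype ι] (u y : L2e ι) : L2e (Fin 2 × ι) := block 0 u + block 1 y

/-! ### Systems -/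

/-- Causality: `Γ_T H u = Γ_T H Γ_T u` for all `T ≥ 0`. -/
def IsCausal {ι κ : Type} [Fintype ι] [Fintype κ] (H : L2e ι → L2e κ) : Prop :=
  ∀ T : ℝ, 0 ≤ T → ∀ u, trunc T (H u) = trunc T (H (trunc T u))

/-- The incremental gain `‖H‖_Δ`, the supremum of `‖Hu - Hv‖ / ‖u - v‖` over distinct
`u, v ∈ L_2`, as an element of `[0, ∞]`. -/
def incGain {ι κ : Type} [Fintype ι] [Fintype κ] (H : L2e ι → L2e κ) : ℝ≥0∞ :=
  ⨆ (u : L2e ι) (v : L2e ι) (_ : InL2 u) (_ : InL2 v) (_ : u ≠ v),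
    l2norm (H u - H v) / l2norm (u - v)

/-- The (non-incremental) gain, the supremum of `‖Hu‖ / ‖u‖` over nonzero `u ∈ L_2`. -/
def gain {ι κ : Type} [Fintype ι] [Fintype κ] (H : L2e ι → L2e κ) : ℝ≥0∞ :=
  ⨆ (u : L2e ι) (_ : InL2 u) (_ : u ≠ 0), l2norm (H u) / l2norm u

/-- `v` is the signal `u` delayed by `s`. -/
def IsDelay {ι : Type} [Fintype ι] (s : ℝ) (u v : L2e ι) : Prop :=
  ∀ᵐ t ∂timeMeasure, v.val t = if s ≤ t then u.val (t - s) else 0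

/-- A system which is linear and time invariant, causal, and bounded. -/
structure IsBoundedCausalLTI {ι κ : Type} [Fintype ι] [Fintype κ] (H : L2e ι → L2e κ) :
    Prop where
  map_add : ∀ u v, H (u + v) = H u + H v
  map_smul : ∀ (c : ℝ) (u), H (c • u) = c • H u
  time_invariant : ∀ s : ℝ, 0 ≤ s → ∀ u v, IsDelay s u v → IsDelay s (H u) (H v)
  causal : IsCausal H
  bounded : incGain H < ∞

/-! ### Fourier transform and frequency response -/

/-- Entrywise inclusion of `ℝ^ι` in `ℂ^ι`. -/
def complexify {ι : Type} [Fintype ι] : EuclideanSpace ℝ ι →L[ℝ] EuclideanSpace ℂ ι :=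
  LinearMap.toContinuousLinearMap
    { toFun := fun x => WithLp.toLp 2 fun i => (x i : ℂ)
      map_add' := by intro x y; ext i; simp
      map_smul' := by intro c x; ext i; simp }

/-- The extension of a signal by `0` to negative times, with values in `ℂ^ι`. -/
def extend {ι : Type} [Fintype ι] (u : L2e ι) : ℝ → EuclideanSpace ℂ ι :=
  (Ici 0).indicator fun t => complexify (u.val t)

theorem memLp_extend {ι : Type} [Fintype ι] {u : L2e ι} (hu : InL2 u) :
    MemLp (extend u) 2 volume :=
  (memLp_indicator_iff_restrict measurableSet_Ici).2 ((complexify (ι := ι)).comp_memLp' hu)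

/-- The Fourier transform `ω ↦ û(jω) = ∫₀^∞ u(t) exp(-jωt) dt` of `u ∈ L_2` in the sense of
Plancherel. Mathlib's transform has kernel `exp(-2πi t ξ)`, whence `ξ = ω / 2π`. -/
def fourierL2 {ι : Type} [Fintype ι] {u : L2e ι} (hu : InL2 u) (ω : ℝ) : EuclideanSpace ℂ ι :=
  (𝓕 ((memLp_extend hu).toLp (extend u)) : Lp (EuclideanSpace ℂ ι) 2 (volume : Measure ℝ))
    (ω / (2 * Real.pi))

/-- `G`, with `G ω` standing for `H(jω)`, is the frequency response of `H`: it is bounded, and the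
Fourier transform of `H u` is `G` times the Fourier transform of `u`, for each `u ∈ L_2`. -/
structure IsFrequencyResponse {ι κ : Type} [Fintype ι] [Fintype κ] (H : L2e ι → L2e κ)
    (G : ℝ → Matrix κ ι ℂ) : Prop where
  bounded : ∃ c : ℝ, ∀ ω i j, ‖G ω i j‖ ≤ c
  fourier_eq : ∀ (u : L2e ι) (hu : InL2 u) (hy : InL2 (H u)),
    ∀ᵐ ω : ℝ, (fourierL2 hy ω).ofLp = G ω *ᵥ (fourierL2 hu ω).ofLp

/-! ### Scaled relative graphs of matrices -/

/-- The gain `ρ(u, y)` from `u ≠ 0` to `y`. -/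
def rho {ι : Type} [Fintype ι] (u y : EuclideanSpace ℂ ι) : ℝ := ‖y‖ / ‖u‖

open Classical in
/-- The phase `θ(u, y)` from `u` to `y`. -/
def theta {ι : Type} [Fintype ι] (u y : EuclideanSpace ℂ ι) : ℝ :=
  if u ≠ 0 ∧ y ≠ 0 then Real.arccos ((inner ℂ u y).re / (‖u‖ * ‖y‖)) else 0

/-- The scaled relative graph of a matrix: the points `ρ(u, Au) exp(± j θ(u, Au))`, `u ≠ 0`. -/
def matrixSRG {ι : Type} [Fintype ι] (A : Matrix ι ι ℂ) : Set ℂ :=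
  {z | ∃ u : EuclideanSpace ℂ ι, u ≠ 0 ∧ ∃ s : ℝ, (s = 1 ∨ s = -1) ∧
    z = (rho u (WithLp.toLp 2 (A *ᵥ u.ofLp)) : ℂ) *
      Complex.exp (Complex.I * ((s * theta u (WithLp.toLp 2 (A *ᵥ u.ofLp)) : ℝ) : ℂ))}

/-- The distance between two sets of complex numbers, with `inf ∅ = ∞`. -/
def setDist (S₁ S₂ : Set ℂ) : ℝ≥0∞ := ⨅ a ∈ S₁, ⨅ b ∈ S₂, edist a b

/-! ### Integral quadratic constraints -/

/-- `H` satisfies the soft incremental IQC with multipliers `(M, N)`. -/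
def SoftIQC {n m : ℕ} (M : Matrix (Fin m) (Fin m) ℝ)
    (N : L2e (Fin 2 × Fin n) → L2e (Fin m)) (H : L2e (Fin n) → L2e (Fin n)) : Prop :=
  ∀ u₁ u₂ : L2e (Fin n), InL2 u₁ → InL2 (H u₁) → InL2 u₂ → InL2 (H u₂) →
    0 ≤ ∫ t, ((N (stack (u₁ - u₂) (H u₁ - H u₂))).val t).ofLp ⬝ᵥ
      (M *ᵥ ((N (stack (u₁ - u₂) (H u₁ - H u₂))).val t).ofLp) ∂timeMeasure

/-- The frequency-domain inequality
`[I; N(jω)]^* diag(Π ⊗ I, -τ M) [I; N(jω)] ⪰ 0` for all `ω`. -/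
def FDI {n m : ℕ} (M : Matrix (Fin m) (Fin m) ℝ) (Nω : ℝ → Matrix (Fin m) (Fin 2 × Fin n) ℂ)
    (P : Matrix (Fin 2) (Fin 2) ℝ) (τ : ℝ) : Prop :=
  ∀ ω : ℝ,
    ((Matrix.fromRows (1 : Matrix (Fin 2 × Fin n) (Fin 2 × Fin n) ℂ) (Nω ω))ᴴ *
      Matrix.fromBlocks (P.map Complex.ofReal ⊗ₖ (1 : Matrix (Fin n) (Fin n) ℂ)) 0 0
        (-((τ : ℂ) • M.map Complex.ofReal)) *
      Matrix.fromRows (1 : Matrix (Fin 2 × Fin n) (Fin 2 × Fin n) ℂ) (Nω ω)).PosSemidef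

/-- The set of all symmetric `Π` that satisfy the frequency-domain inequality for some `τ > 0`. -/
def multiplierSet {n m : ℕ} (M : Matrix (Fin m) (Fin m) ℝ)
    (Nω : ℝ → Matrix (Fin m) (Fin 2 × Fin n) ℂ) : Set (Matrix (Fin 2) (Fin 2) ℝ) :=
  {P | P.IsSymm ∧ ∃ τ : ℝ, 0 < τ ∧ FDI M Nω P τ}

/-- The region `C(M, N)`: the intersection over all admissible `Π` of
`{z | [z; 1]^* Π [z; 1] ≥ 0}`. -/
def regionC {n m : ℕ} (M : Matrix (Fin m) (Fin m) ℝ)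
    (Nω : ℝ → Matrix (Fin m) (Fin 2 × Fin n) ℂ) : Set ℂ :=
  ⋂ P ∈ multiplierSet M Nω,
    {z : ℂ | 0 ≤ (star ![z, 1] ⬝ᵥ (P.map Complex.ofReal *ᵥ ![z, 1])).re}

/-! ### The feedback interconnection -/

/-- The loop equations `u₁ = w + y₂`, `u₂ = y₁`, `y₁ = H₁ u₁`, `y₂ = H₂ u₂`. -/
def Interconnection {n : ℕ} (H₁ H₂ : L2e (Fin n) → L2e (Fin n))
    (w u₁ y₁ u₂ y₂ : L2e (Fin n)) : Prop :=
  u₁ = w + y₂ ∧ u₂ = y₁ ∧ y₁ = H₁ u₁ ∧ y₂ = H₂ u₂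

/-- Well-posedness: the mapping `u₁ ↦ w = u₁ - H₂ H₁ u₁` has a causal inverse on `L_{2e}`. -/
def WellPosed {n : ℕ} (H₁ H₂ : L2e (Fin n) → L2e (Fin n)) : Prop :=
  ∃ F : L2e (Fin n) → L2e (Fin n), IsCausal F ∧
    Function.LeftInverse F (fun u₁ => u₁ - H₂ (H₁ u₁)) ∧
    Function.RightInverse F (fun u₁ => u₁ - H₂ (H₁ u₁))

/-- `T` is the closed-loop map `w ↦ y₁`. -/
def IsClosedLoopMap {n : ℕ} (H₁ H₂ T : L2e (Fin n) → L2e (Fin n)) : Prop :=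
  ∀ w y₁, T w = y₁ ↔ ∃ u₁ u₂ y₂, Interconnection H₁ H₂ w u₁ y₁ u₂ y₂

end Lure

end

noncomputable section

namespace Lure

variable {ι κ : Type} [Fintype ι] [Fintype κ]

/-! ### The Fourier transform on `L²` and constant linear maps -/

/-! The theorem rests on one frequency-domain inequality. The gain and phase of a pair `(A v, v)`
determine the value of `Π ⊗ I` on it: this value is `‖v‖²` times the plane form of `Π` at the point
of the SRG given by `v`. A point at distance at least `r` from `C(M, N)` makes some admissible `Π`
negative, and the FDI then forces the form `M` to be negative on `N [A v; v]`. Boundedness of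
`H₁(jω)` confines the SRGs to a compact set, so the negativity is uniform in `ω`
(`exists_quadForm_le`).

In the loop, the increment of `(u₂, y₂)` is `(H₁ Δu, Δu - Δw)`, a perturbation by `Δw` of such a
pair. Integrating with Parseval and comparing with the IQC gives `‖Δu‖ ≤ C ‖Δw‖`
(`exists_apriori_bound`). The constant sees the second system only through its IQC, hence is the
same for all `μ H₂`.

This bound presupposes that the loop signals lie in `L₂`. That is shown by continuation in `μ` from
the trivial loop at `μ = 0` (`stableLoop_one`): with `C` fixed, each step can have the same length.
Only the finite gain of `H₂` enters here. At `μ = 1` the incremental bound then applies to any two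
solutions with external signals in `L₂`. -/

theorem schwartz_fourier_postcomp {F G : Type*} [NormedAddCommGroup F] [InnerProductSpace ℂ F]
    [CompleteSpace F] [NormedAddCommGroup G] [InnerProductSpace ℂ G] [CompleteSpace G]
    (L : F →L[ℂ] G) (f : SchwartzMap ℝ F) :
    𝓕 (SchwartzMap.postcompCLM L f) = SchwartzMap.postcompCLM L (𝓕 f) := by
  ext ξ
  rw [SchwartzMap.postcompCLM_apply, SchwartzMap.fourier_coe, SchwartzMap.fourier_coe,
    Real.fourier_eq, Real.fourier_eq, ← L.integral_comp_comm]
  · simp [Circle.smul_def]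
  · exact (Real.fourierIntegral_convergent_iff ξ).2 f.integrable

theorem compLp_schwartz {F G : Type*} [NormedAddCommGroup F] [InnerProductSpace ℂ F]
    [NormedAddCommGroup G] [InnerProductSpace ℂ G]
    (L : F →L[ℂ] G) (f : SchwartzMap ℝ F) :
    L.compLp (f.toLp 2 (volume : Measure ℝ)) = (SchwartzMap.postcompCLM L f).toLp 2 := by
  apply Lp.ext
  filter_upwards [L.coeFn_compLp (f.toLp 2 (volume : Measure ℝ)), f.coeFn_toLp 2 volume,
    (SchwartzMap.postcompCLM L f).coeFn_toLp 2 volume] with t h1 h2 h3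
  rw [h1, h2, h3, SchwartzMap.postcompCLM_apply]

/-- The Fourier transform on `L²` commutes with constant linear maps. -/
theorem fourier_compLp {F G : Type*} [NormedAddCommGroup F] [InnerProductSpace ℂ F]
    [CompleteSpace F] [NormedAddCommGroup G] [InnerProductSpace ℂ G] [CompleteSpace G]
    (L : F →L[ℂ] G) (f : Lp F 2 (volume : Measure ℝ)) :
    𝓕 (L.compLp f) = L.compLp (𝓕 f) := by
  -- Both sides are continuous in `f` by Plancherel, so Schwartz functions suffice; there `L` passes
  -- through the Fourier integral.
  refine DenseRange.induction_on (p := fun f : Lp F 2 (volume : Measure ℝ) =>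
    𝓕 (L.compLp f) = L.compLp (𝓕 f))
    (SchwartzMap.denseRange_toLpCLM (p := 2) ENNReal.ofNat_ne_top) f ?_ ?_
  · refine isClosed_eq ?_ ?_
    · exact (Lp.fourierTransformₗᵢ ℝ G).continuous.comp (L.compLpL 2 volume).continuous
    · exact (L.compLpL 2 volume).continuous.comp (Lp.fourierTransformₗᵢ ℝ F).continuous
  · intro g
    simp only [SchwartzMap.toLpCLM_apply]
    rw [compLp_schwartz, SchwartzMap.toLp_fourier_eq, SchwartzMap.toLp_fourier_eq,
      compLp_schwartz, schwartz_fourier_postcomp]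

/-! ### Transforms of signals -/

/-- The Fourier transform of a signal in `L_2`, in the frequency variable of Mathlib. -/
def signalFourier {u : L2e ι} (hu : InL2 u) : Lp (EuclideanSpace ℂ ι) 2 (volume : Measure ℝ) :=
  𝓕 ((memLp_extend hu).toLp (extend u))

theorem norm_complexify (x : EuclideanSpace ℝ ι) : ‖complexify x‖ = ‖x‖ := by
  simp [complexify, EuclideanSpace.norm_eq]

theorem eLpNorm_extend (u : L2e ι) : eLpNorm (extend u) 2 volume = l2norm u := by
  rw [extend, eLpNorm_indicator_eq_eLpNorm_restrict measurableSet_Ici, l2norm]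
  exact eLpNorm_congr_norm_ae (Filter.Eventually.of_forall fun t => norm_complexify _)

theorem norm_signalFourier {u : L2e ι} (hu : InL2 u) :
    ‖signalFourier hu‖ = (l2norm u).toReal := by
  rw [signalFourier, Lp.norm_fourier_eq, Lp.norm_toLp, eLpNorm_extend]

theorem fourierL2_two_pi_mul {u : L2e ι} (hu : InL2 u) (ξ : ℝ) :
    fourierL2 hu (2 * Real.pi * ξ) = signalFourier hu ξ := by
  rw [fourierL2, signalFourier, mul_div_cancel_left₀ _ (by positivity)]

theorem InL2.add {u v : L2e ι} (hu : InL2 u) (hv : InL2 v) : InL2 (u + v) :=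
  (memLp_congr_ae (AEEqFun.coeFn_add u.val v.val)).2 (MemLp.add hu hv)

theorem InL2.sub {u v : L2e ι} (hu : InL2 u) (hv : InL2 v) : InL2 (u - v) :=
  (memLp_congr_ae (AEEqFun.coeFn_sub u.val v.val)).2 (MemLp.sub hu hv)

theorem InL2.smul (c : ℝ) {u : L2e ι} (hu : InL2 u) : InL2 (c • u) :=
  (memLp_congr_ae (AEEqFun.coeFn_smul c u.val)).2 (MemLp.const_smul hu c)

theorem inL2_zero : InL2 (0 : L2e ι) :=
  (memLp_congr_ae AEEqFun.coeFn_zero).2 MemLp.zero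

theorem ae_of_ae_timeMeasure {p : ℝ → Prop} (h : ∀ᵐ t ∂timeMeasure, p t) :
    ∀ᵐ t, t ∈ Ici (0 : ℝ) → p t := (ae_restrict_iff' measurableSet_Ici).1 h

theorem extend_add (u v : L2e ι) : extend (u + v) =ᵐ[volume] extend u + extend v := by
  filter_upwards [ae_of_ae_timeMeasure (AEEqFun.coeFn_add u.val v.val)] with t ht
  by_cases h : t ∈ Ici (0 : ℝ)
  · have := ht h
    simp only [extend, Pi.add_apply, indicator_of_mem h, Submodule.coe_add, this, map_add]
  · simp [extend, indicator_of_notMem h]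

theorem signalFourier_add {u v : L2e ι} (hu : InL2 u) (hv : InL2 v) (h : InL2 (u + v)) :
    signalFourier h = signalFourier hu + signalFourier hv := by
  rw [signalFourier, signalFourier, signalFourier, ← FourierAdd.fourier_add, ← MemLp.toLp_add]
  congr 1
  exact (MemLp.toLp_eq_toLp_iff _ _).2 (extend_add u v)

/-- The complex linear map placing a vector in block `k` of a two-block vector. -/
def complexBlock (k : Fin 2) : EuclideanSpace ℂ ι →L[ℂ] EuclideanSpace ℂ (Fin 2 × ι) :=
  LinearMap.toContinuousLinearMap
    { toFun := fun x => WithLp.toLp 2 fun p => if p.1 = k then x p.2 else 0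
      map_add' := by
        intro x y
        ext p
        by_cases h : p.1 = k <;> simp [h]
      map_smul' := by
        intro c x
        ext p
        by_cases h : p.1 = k <;> simp [h] }

theorem complexBlock_apply (k : Fin 2) (x : EuclideanSpace ℂ ι) (p : Fin 2 × ι) :
    complexBlock k x p = if p.1 = k then x p.2 else 0 := rfl

theorem complexify_blockCLM (k : Fin 2) (x : EuclideanSpace ℝ ι) :
    complexify (blockCLM k x) = complexBlock k (complexify x) := by
  ext p
  by_cases h : p.1 = k <;> simp [complexify, blockCLM, complexBlock, h]

theorem InL2.block (k : Fin 2) {u : L2e ι} (hu : InL2 u) : InL2 (block k u) :=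
  (memLp_congr_ae (AEEqFun.coeFn_comp (blockCLM (ι := ι) k) (blockCLM k).continuous u.val)).2
    ((blockCLM (ι := ι) k).comp_memLp' hu)

theorem InL2.stack {u y : L2e ι} (hu : InL2 u) (hy : InL2 y) : InL2 (stack u y) :=
  (hu.block 0).add (hy.block 1)

theorem signalFourier_block (k : Fin 2) {u : L2e ι} (hu : InL2 u) :
    signalFourier (hu.block k) = (complexBlock k).compLp (signalFourier hu) := by
  rw [signalFourier, signalFourier, ← fourier_compLp]
  congr 1
  apply Lp.ext
  filter_upwards [(memLp_extend (hu.block k)).coeFn_toLp, (memLp_extend hu).coeFn_toLp,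
    (complexBlock k).coeFn_compLp ((memLp_extend hu).toLp (extend u)),
    ae_of_ae_timeMeasure
      (AEEqFun.coeFn_comp (blockCLM (ι := ι) k) (blockCLM k).continuous u.val)] with t h1 h2 h3 h4
  rw [h1, h3, h2]
  by_cases h : t ∈ Ici (0 : ℝ)
  · simp only [extend, indicator_of_mem h]
    rw [← complexify_blockCLM]
    exact congrArg _ (h4 h)
  · simp [extend, indicator_of_notMem h]

theorem signalFourier_stack {u y : L2e ι} (hu : InL2 u) (hy : InL2 y) :
    ∀ᵐ ξ, signalFourier (hu.stack hy) ξ =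
      complexBlock 0 (signalFourier hu ξ) + complexBlock 1 (signalFourier hy ξ) := by
  have h : signalFourier (hu.stack hy) = (complexBlock 0).compLp (signalFourier hu) +
      (complexBlock 1).compLp (signalFourier hy) := by
    rw [← signalFourier_block, ← signalFourier_block]
    exact signalFourier_add (hu.block 0) (hy.block 1) (hu.stack hy)
  filter_upwards [Lp.coeFn_add ((complexBlock 0).compLp (signalFourier hu))
    ((complexBlock 1).compLp (signalFourier hy)),
    (complexBlock 0).coeFn_compLp (signalFourier hu),
    (complexBlock 1).coeFn_compLp (signalFourier hy)] with ξ h1 h2 h3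
  rw [h, h1, Pi.add_apply, h2, h3]

/-! ### Matrices and quadratic forms -/

/-- A complex matrix as a continuous linear map between Euclidean spaces. -/
def matrixCLM (A : Matrix κ ι ℂ) : EuclideanSpace ℂ ι →L[ℂ] EuclideanSpace ℂ κ :=
  LinearMap.toContinuousLinearMap
    { toFun := fun x => WithLp.toLp 2 (A *ᵥ x.ofLp)
      map_add' := by
        intro x y
        simp [Matrix.mulVec_add]
      map_smul' := by
        intro c x
        simp [Matrix.mulVec_smul] }

theorem matrixCLM_apply (A : Matrix κ ι ℂ) (x : EuclideanSpace ℂ ι) :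
    matrixCLM A x = WithLp.toLp 2 (A *ᵥ x.ofLp) := rfl

theorem ae_signalFourier_eq {H : L2e ι → L2e κ} {G : ℝ → Matrix κ ι ℂ}
    (h : IsFrequencyResponse H G) {u : L2e ι} (hu : InL2 u) (hy : InL2 (H u)) :
    ∀ᵐ ξ : ℝ, signalFourier hy ξ = matrixCLM (G (2 * Real.pi * ξ)) (signalFourier hu ξ) := by
  -- The frequency response is prescribed only for almost every `ω`; the substitution `ω = 2πξ` must
  -- pull null sets back to null sets.
  have hq : Measure.QuasiMeasurePreserving (fun ξ : ℝ => 2 * Real.pi * ξ) volume volume := by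
    refine ⟨by fun_prop, ?_⟩
    rw [Real.map_volume_mul_left (by positivity)]
    exact Measure.smul_absolutelyContinuous
  filter_upwards [hq.ae (h.fourier_eq u hu hy)] with ξ hξ
  rw [fourierL2_two_pi_mul, fourierL2_two_pi_mul] at hξ
  rw [matrixCLM_apply, ← hξ]

/-- The quadratic form `Re (x^* M x)` of a real matrix. -/
def quadForm (M : Matrix κ κ ℝ) (x : EuclideanSpace ℂ κ) : ℝ :=
  (inner ℂ x (matrixCLM (M.map Complex.ofReal) x)).re

theorem quadForm_complexify (M : Matrix κ κ ℝ) (x : EuclideanSpace ℝ κ) :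
    quadForm M (complexify x) = x.ofLp ⬝ᵥ (M *ᵥ x.ofLp) := by
  simp only [quadForm, matrixCLM_apply, complexify, PiLp.inner_apply, dotProduct, Matrix.mulVec,
    LinearMap.coe_toContinuousLinearMap', LinearMap.coe_mk, AddHom.coe_mk, Matrix.map_apply]
  rw [Complex.re_sum]
  refine Finset.sum_congr rfl fun i _ => ?_
  simp only [RCLike.inner_apply, Complex.conj_ofReal, ← Complex.ofReal_mul, ← Complex.ofReal_sum,
    Complex.ofReal_re]
  ring

theorem integrable_quadForm (M : Matrix κ κ ℝ)
    (f : Lp (EuclideanSpace ℂ κ) 2 (volume : Measure ℝ)) :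
    Integrable (fun ξ => quadForm M (f ξ)) volume := by
  have h := (L2.integrable_inner (𝕜 := ℂ) f ((matrixCLM (M.map Complex.ofReal)).compLp f)).re
  refine h.congr ?_
  filter_upwards [(matrixCLM (M.map Complex.ofReal)).coeFn_compLp f] with ξ hξ
  simp [quadForm, hξ]

theorem integral_quadForm (M : Matrix κ κ ℝ)
    (f : Lp (EuclideanSpace ℂ κ) 2 (volume : Measure ℝ)) :
    ∫ ξ, quadForm M (f ξ) =
      (inner ℂ f ((matrixCLM (M.map Complex.ofReal)).compLp f)).re := by
  rw [L2.inner_def]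
  have h := L2.integrable_inner (𝕜 := ℂ) f ((matrixCLM (M.map Complex.ofReal)).compLp f)
  have h2 := integral_re h
  simp only [RCLike.re_eq_complex_re] at h2
  rw [← h2]
  refine integral_congr_ae ?_
  filter_upwards [(matrixCLM (M.map Complex.ofReal)).coeFn_compLp f] with ξ hξ
  simp [quadForm, hξ]

/-- Parseval's identity for quadratic forms of signals. -/
theorem integral_quadForm_signalFourier (M : Matrix κ κ ℝ) {g : L2e κ} (hg : InL2 g) :
    ∫ ξ, quadForm M (signalFourier hg ξ) =
      ∫ t, (g.val t).ofLp ⬝ᵥ (M *ᵥ (g.val t).ofLp) ∂timeMeasure := by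
  -- The integral is the real part of `⟨f, M f⟩` in `L²`. The constant matrix `M` commutes with the
  -- transform, which preserves inner products.
  rw [integral_quadForm, signalFourier, ← fourier_compLp, Lp.inner_fourier_eq,
    ← integral_quadForm]
  rw [← integral_indicator measurableSet_Ici]
  refine integral_congr_ae ?_
  filter_upwards [(memLp_extend hg).coeFn_toLp] with t ht
  rw [ht]
  by_cases h : t ∈ Ici (0 : ℝ)
  · simp only [extend, indicator_of_mem h, quadForm_complexify]
  · simp [extend, indicator_of_notMem h, quadForm]

theorem integral_norm_sq_signalFourier {u : L2e ι} (hu : InL2 u) :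
    ∫ ξ, ‖signalFourier hu ξ‖ ^ 2 = (l2norm u).toReal ^ 2 := by
  rw [← norm_signalFourier hu, ← real_inner_self_eq_norm_sq, L2.inner_def]
  simp

theorem integrable_norm_sq (f : Lp (EuclideanSpace ℂ κ) 2 (volume : Measure ℝ)) :
    Integrable (fun ξ => ‖f ξ‖ ^ 2) volume :=
  (Lp.memLp f).integrable_norm_pow two_ne_zero

/-! ### Pointwise consequences of the separation of the graphs -/

/-- A crude triangle-inequality bound; what matters is that it depends only on the entry bound and
hence is uniform in `ω`. -/
theorem norm_matrixCLM_le {A : Matrix κ ι ℂ} {c : ℝ} (hA : ∀ i j, ‖A i j‖ ≤ c)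
    (x : EuclideanSpace ℂ ι) :
    ‖matrixCLM A x‖ ≤ (Fintype.card κ * (Fintype.card ι * c)) * ‖x‖ := by
  classical
  have hi : ∀ i, ‖matrixCLM A x i‖ ≤ Fintype.card ι * c * ‖x‖ := by
    intro i
    have h : matrixCLM A x i = ∑ j, A i j * x j := rfl
    rw [h, mul_assoc]
    refine (norm_sum_le _ _).trans ?_
    have : ∀ j ∈ Finset.univ, ‖A i j * x j‖ ≤ c * ‖x‖ := fun j _ => by
      rw [norm_mul]
      exact mul_le_mul (hA i j) (PiLp.norm_apply_le x j) (norm_nonneg _)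
        ((norm_nonneg _).trans (hA i j))
    simpa using Finset.sum_le_sum this
  have hsum := (EuclideanSpace.basisFun κ ℂ).sum_repr (matrixCLM A x)
  rw [← hsum]
  refine (norm_sum_le _ _).trans ?_
  have : ∀ i ∈ Finset.univ, ‖(EuclideanSpace.basisFun κ ℂ).repr (matrixCLM A x) i •
      EuclideanSpace.basisFun κ ℂ i‖ ≤ Fintype.card ι * c * ‖x‖ := fun i _ => by
    rw [norm_smul, OrthonormalBasis.norm_eq_one, mul_one]
    simpa using hi i
  simpa [mul_assoc] using Finset.sum_le_sum this

/-- The value `[z; 1]^* Π [z; 1]` for symmetric `Π`. -/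
def planeForm (P : Matrix (Fin 2) (Fin 2) ℝ) (z : ℂ) : ℝ :=
  P 0 0 * ‖z‖ ^ 2 + 2 * P 0 1 * z.re + P 1 1

theorem re_dotProduct_eq_planeForm {P : Matrix (Fin 2) (Fin 2) ℝ} (hP : P.IsSymm) (z : ℂ) :
    (star ![z, 1] ⬝ᵥ (P.map Complex.ofReal *ᵥ ![z, 1])).re = planeForm P z := by
  have h10 : P 1 0 = P 0 1 := hP.apply 0 1
  have hz : ‖z‖ ^ 2 = z.re * z.re + z.im * z.im := by
    rw [← Complex.normSq_eq_norm_sq, Complex.normSq_apply]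
  simp [dotProduct, Matrix.mulVec, Fin.sum_univ_two, planeForm, hz, h10]
  ring

theorem continuous_planeForm (P : Matrix (Fin 2) (Fin 2) ℝ) : Continuous (planeForm P) := by
  unfold planeForm
  fun_prop

/-- The identity factor in `Π ⊗ I` leaves only `‖a‖²`, `Re ⟨b, a⟩` and `‖b‖²`. For `a = A v`, `b =
v` these are exactly the data recorded by the SRG. -/
theorem re_dotProduct_kronecker {n : ℕ} {P : Matrix (Fin 2) (Fin 2) ℝ} (hP : P.IsSymm)
    (a b : EuclideanSpace ℂ (Fin n)) :
    (star (complexBlock 0 a + complexBlock 1 b).ofLp ⬝ᵥ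
      ((P.map Complex.ofReal ⊗ₖ (1 : Matrix (Fin n) (Fin n) ℂ)) *ᵥ
        (complexBlock 0 a + complexBlock 1 b).ofLp)).re =
      P 0 0 * ‖a‖ ^ 2 + 2 * P 0 1 * (inner ℂ b a).re + P 1 1 * ‖b‖ ^ 2 := by
  have h10 : P 1 0 = P 0 1 := hP.apply 0 1
  have e : ∀ k i, (complexBlock 0 a + complexBlock 1 b).ofLp (k, i) = ![a i, b i] k := by
    intro k i
    fin_cases k <;> simp [complexBlock_apply]
  have hm : ∀ k i, ((P.map Complex.ofReal ⊗ₖ (1 : Matrix (Fin n) (Fin n) ℂ)) *ᵥ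
        (complexBlock 0 a + complexBlock 1 b).ofLp) (k, i) = P k 0 * a i + P k 1 * b i := by
    intro k i
    simp only [Matrix.mulVec, dotProduct, Fintype.sum_prod_type, Matrix.kroneckerMap_apply, e]
    simp [Matrix.one_apply, Fin.sum_univ_two]
  simp only [dotProduct, Fintype.sum_prod_type, hm, Pi.star_apply, e, Fin.sum_univ_two]
  simp only [EuclideanSpace.norm_sq_eq, PiLp.inner_apply, ← Finset.sum_add_distrib,
    Finset.mul_sum, Complex.re_sum, Complex.add_re]
  refine Finset.sum_congr rfl fun i _ => ?_
  rw [← Complex.normSq_eq_norm_sq, ← Complex.normSq_eq_norm_sq, Complex.normSq_apply,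
    Complex.normSq_apply]
  simp [h10]
  ring

/-- Positive semidefiniteness is tested on `x`, which `[I; N(jω)]` sends to `(x, N(jω) x)`. -/
theorem FDI.mul_quadForm_le {n m : ℕ} {M : Matrix (Fin m) (Fin m) ℝ}
    {Nω : ℝ → Matrix (Fin m) (Fin 2 × Fin n) ℂ} {P : Matrix (Fin 2) (Fin 2) ℝ} {τ : ℝ}
    (h : FDI M Nω P τ) (ω : ℝ) (x : EuclideanSpace ℂ (Fin 2 × Fin n)) :
    τ * quadForm M (matrixCLM (Nω ω) x) ≤
      (star x.ofLp ⬝ᵥ ((P.map Complex.ofReal ⊗ₖ (1 : Matrix (Fin n) (Fin n) ℂ)) *ᵥ x.ofLp)).re := by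
  have h1 := (h ω).re_dotProduct_nonneg x.ofLp
  rw [← Matrix.mulVec_mulVec, ← Matrix.mulVec_mulVec, Matrix.dotProduct_mulVec,
    ← Matrix.star_mulVec, Matrix.fromRows_mulVec, Matrix.one_mulVec,
    Matrix.fromBlocks_mulVec] at h1
  have hq : quadForm M (matrixCLM (Nω ω) x) =
      (star (Nω ω *ᵥ x.ofLp) ⬝ᵥ (M.map Complex.ofReal *ᵥ (Nω ω *ᵥ x.ofLp))).re := by
    rw [quadForm, EuclideanSpace.inner_eq_star_dotProduct, dotProduct_comm]
    rfl
  have hs : star (Sum.elim x.ofLp (Nω ω *ᵥ x.ofLp)) =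
      Sum.elim (star x.ofLp) (star (Nω ω *ᵥ x.ofLp)) := by
    ext (i | i) <;> simp
  rw [hs, sumElim_dotProduct_sumElim] at h1
  simp [Matrix.neg_mulVec, Matrix.smul_mulVec, dotProduct_neg, dotProduct_smul] at h1
  rwa [hq, Matrix.mulVec_mulVec]

/-- Every nonzero vector yields a point of the scaled relative graph with the same gain and the
same real part. -/
theorem exists_mem_matrixSRG (A : Matrix ι ι ℂ) {v : EuclideanSpace ℂ ι} (hv : v ≠ 0) :
    ∃ z ∈ matrixSRG A, ‖z‖ * ‖v‖ = ‖matrixCLM A v‖ ∧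
      z.re * ‖v‖ ^ 2 = (inner ℂ v (matrixCLM A v)).re := by
  refine ⟨_, ⟨v, hv, 1, Or.inl rfl, rfl⟩, ?_, ?_⟩
  · rw [norm_mul, mul_comm Complex.I, Complex.norm_exp_ofReal_mul_I, mul_one, Complex.norm_real,
      rho, Real.norm_of_nonneg (by positivity), div_mul_cancel₀ _ (norm_ne_zero_iff.2 hv)]
    rfl
  · rw [← matrixCLM_apply, mul_comm Complex.I, Complex.re_ofReal_mul, Complex.exp_ofReal_mul_I_re,
      one_mul, rho]
    by_cases hy : matrixCLM A v = 0
    · simp [hy]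
    · have hv' := norm_pos_iff.2 hv
      have hy' := norm_pos_iff.2 hy
      -- Cauchy–Schwarz puts the argument of `arccos` in `[-1, 1]`, where `cos` inverts it.
      have hb : |(inner ℂ v (matrixCLM A v)).re| ≤ ‖v‖ * ‖matrixCLM A v‖ :=
        (Complex.abs_re_le_norm _).trans (norm_inner_le_norm _ _)
      rw [abs_le] at hb
      rw [theta, if_pos ⟨hv, hy⟩, Real.cos_arccos]
      · field_simp
      · rw [le_div_iff₀ (by positivity)]; linarith
      · rw [div_le_iff₀ (by positivity)]; linarith

/-- Compactness: a `Π` that excludes `z` also excludes a neighbourhood of `z`, and finitely many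
neighbourhoods cover `K`. The margin is measured relative to `τ` because the IQC form enters the FDI
with weight `τ`, which is divided out later. -/
theorem exists_uniform_planeForm_le {n m : ℕ} {M : Matrix (Fin m) (Fin m) ℝ}
    {Nω : ℝ → Matrix (Fin m) (Fin 2 × Fin n) ℂ} {K : Set ℂ} (hK : IsCompact K)
    (hd : Disjoint K (regionC M Nω)) :
    ∃ ε : ℝ, 0 < ε ∧ ∀ z ∈ K, ∃ P : Matrix (Fin 2) (Fin 2) ℝ, P.IsSymm ∧ ∃ τ : ℝ, 0 < τ ∧
      FDI M Nω P τ ∧ planeForm P z ≤ -(ε * τ) := by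
  refine hK.induction_on (p := fun S => ∃ ε : ℝ, 0 < ε ∧ ∀ z ∈ S,
    ∃ P : Matrix (Fin 2) (Fin 2) ℝ, P.IsSymm ∧ ∃ τ : ℝ, 0 < τ ∧
      FDI M Nω P τ ∧ planeForm P z ≤ -(ε * τ)) ?_ ?_ ?_ ?_
  · exact ⟨1, one_pos, by simp⟩
  · rintro S S' hS ⟨ε, hε, h⟩
    exact ⟨ε, hε, fun z hz => h z (hS hz)⟩
  · rintro S S' ⟨ε, hε, h⟩ ⟨ε', hε', h'⟩
    refine ⟨min ε ε', lt_min hε hε', ?_⟩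
    rintro z (hz | hz)
    · obtain ⟨P, hP, τ, hτ, hF, hz⟩ := h z hz
      exact ⟨P, hP, τ, hτ, hF, hz.trans (neg_le_neg (by gcongr; exact min_le_left _ _))⟩
    · obtain ⟨P, hP, τ, hτ, hF, hz⟩ := h' z hz
      exact ⟨P, hP, τ, hτ, hF, hz.trans (neg_le_neg (by gcongr; exact min_le_right _ _))⟩
  · intro z hz
    have hzC : z ∉ regionC M Nω := fun h => hd.le_bot ⟨hz, h⟩
    simp only [regionC, mem_iInter, not_forall] at hzC
    obtain ⟨P, ⟨hP, τ, hτ, hF⟩, hneg⟩ := hzC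
    rw [mem_ofPred_eq, re_dotProduct_eq_planeForm hP, not_le] at hneg
    -- On this neighbourhood the form stays below half its negative value at `z`; the margin is that
    -- half divided by `τ`.
    refine ⟨{z' | planeForm P z' < planeForm P z / 2}, mem_nhdsWithin_of_mem_nhds
      ((continuous_planeForm P).continuousAt.eventually_lt continuousAt_const (by linarith)),
      -planeForm P z / (2 * τ), by apply div_pos <;> linarith, fun z' hz' => ⟨P, hP, τ, hτ, hF, ?_⟩⟩
    have : -(-planeForm P z / (2 * τ) * τ) = planeForm P z / 2 := by field_simp
    rw [this]
    exact le_of_lt hz'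

/-- Separation of the scaled relative graph from the region yields a uniformly strict
frequency-domain inequality on the graph of the matrices `A ω`. -/
theorem exists_quadForm_le {n m : ℕ} {M : Matrix (Fin m) (Fin m) ℝ}
    {Nω : ℝ → Matrix (Fin m) (Fin 2 × Fin n) ℂ} {A : ℝ → Matrix (Fin n) (Fin n) ℂ}
    (hA : ∃ c : ℝ, ∀ ω i j, ‖A ω i j‖ ≤ c) {r : ℝ} (hr : 0 < r)
    (hd : ∀ ω, ENNReal.ofReal r ≤ setDist (matrixSRG (A ω)) (regionC M Nω)) :
    ∃ ε : ℝ, 0 < ε ∧ ∀ ω (v : EuclideanSpace ℂ (Fin n)),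
      quadForm M (matrixCLM (Nω ω) (complexBlock 0 (matrixCLM (A ω) v) + complexBlock 1 v)) ≤
        -(ε * ‖v‖ ^ 2) := by
  obtain ⟨c, hc⟩ := hA
  set c' : ℝ := Fintype.card (Fin n) * (Fintype.card (Fin n) * c)
  -- A single compact set containing the SRGs for all `ω`. The ball keeps it bounded even if the
  -- region is empty and the intersection imposes nothing.
  let K : Set ℂ := Metric.closedBall 0 c' ∩ ⋂ b ∈ regionC M Nω, {z | r ≤ dist z b}
  have hK : IsCompact K := (isCompact_closedBall _ _).inter_right
    (isClosed_biInter fun b _ => isClosed_le continuous_const (by fun_prop))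
  have hdK : Disjoint K (regionC M Nω) := by
    rw [Set.disjoint_left]
    intro z hz hzC
    have := mem_iInter₂.1 hz.2 z hzC
    rw [mem_ofPred_eq, dist_self] at this
    linarith
  obtain ⟨ε, hε, h⟩ := exists_uniform_planeForm_le hK hdK
  refine ⟨ε, hε, fun ω v => ?_⟩
  by_cases hv : v = 0
  · simp [hv, quadForm]
  have hv' : 0 < ‖v‖ := norm_pos_iff.2 hv
  obtain ⟨z, hz, hnorm, hre⟩ := exists_mem_matrixSRG (A ω) hv
  have hzK : z ∈ K := by
    constructor
    · rw [mem_closedBall_zero_iff]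
      refine le_of_mul_le_mul_right ?_ hv'
      rw [hnorm]
      exact norm_matrixCLM_le (hc ω) v
    · refine mem_iInter₂.2 fun b hb => ?_
      have h1 : setDist (matrixSRG (A ω)) (regionC M Nω) ≤ edist z b :=
        (iInf₂_le z hz).trans (iInf₂_le b hb)
      have h2 := (hd ω).trans h1
      rw [edist_dist] at h2
      exact (ENNReal.ofReal_le_ofReal_iff dist_nonneg).1 h2
  obtain ⟨P, hP, τ, hτ, hF, hPz⟩ := h z hzK
  have h1 := hF.mul_quadForm_le ω (complexBlock 0 (matrixCLM (A ω) v) + complexBlock 1 v)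
  rw [re_dotProduct_kronecker hP, ← hre, ← hnorm] at h1
  have h2 : P 0 0 * (‖z‖ * ‖v‖) ^ 2 + 2 * P 0 1 * (z.re * ‖v‖ ^ 2) + P 1 1 * ‖v‖ ^ 2 =
      planeForm P z * ‖v‖ ^ 2 := by
    rw [planeForm]; ring
  rw [h2] at h1
  have h3 : planeForm P z * ‖v‖ ^ 2 ≤ -(ε * τ) * ‖v‖ ^ 2 := by gcongr
  refine le_of_mul_le_mul_left ?_ hτ
  linarith

/-! ### Norms and gains -/

/-- The real-valued `L_2` norm, meaningful for signals in `L_2`. -/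
def realNorm (u : L2e ι) : ℝ := (l2norm u).toReal

theorem realNorm_nonneg (u : L2e ι) : 0 ≤ realNorm u := ENNReal.toReal_nonneg

theorem inL2_iff {u : L2e ι} : InL2 u ↔ l2norm u < ∞ :=
  ⟨fun h => h.2, fun h => ⟨u.val.aestronglyMeasurable, h⟩⟩

theorem InL2.ofReal_realNorm {u : L2e ι} (hu : InL2 u) :
    ENNReal.ofReal (realNorm u) = l2norm u := ENNReal.ofReal_toReal (inL2_iff.1 hu).ne

theorem L2e_sub_zero (u : L2e ι) : u - 0 = u := sub_zero (G := L2e ι) u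

theorem l2norm_zero : l2norm (0 : L2e ι) = 0 := by
  rw [l2norm, Submodule.coe_zero, eLpNorm_congr_ae AEEqFun.coeFn_zero]
  exact eLpNorm_zero

theorem l2norm_ne_zero {u : L2e ι} (hu : u ≠ 0) : l2norm u ≠ 0 := by
  intro h
  rw [l2norm, eLpNorm_eq_zero_iff u.val.aestronglyMeasurable two_ne_zero] at h
  exact hu (Subtype.ext (AEEqFun.ext (h.trans AEEqFun.coeFn_zero.symm)))

theorem l2norm_add_le (u v : L2e ι) : l2norm (u + v) ≤ l2norm u + l2norm v := by
  rw [l2norm, Submodule.coe_add, eLpNorm_congr_ae (AEEqFun.coeFn_add u.val v.val)]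
  exact eLpNorm_add_le u.val.aestronglyMeasurable v.val.aestronglyMeasurable one_le_two

theorem l2norm_smul (c : ℝ) (u : L2e ι) : l2norm (c • u) = ‖c‖ₑ * l2norm u := by
  rw [l2norm, Submodule.coe_smul, eLpNorm_congr_ae (AEEqFun.coeFn_smul c u.val)]
  exact eLpNorm_const_smul _ _ _ _

theorem realNorm_add_le {u v : L2e ι} (hu : InL2 u) (hv : InL2 v) :
    realNorm (u + v) ≤ realNorm u + realNorm v := by
  rw [realNorm, realNorm, realNorm,
    ← ENNReal.toReal_add (inL2_iff.1 hu).ne (inL2_iff.1 hv).ne]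
  exact ENNReal.toReal_mono (ENNReal.add_lt_top.2 ⟨inL2_iff.1 hu, inL2_iff.1 hv⟩).ne
    (l2norm_add_le u v)

theorem realNorm_smul (c : ℝ) (u : L2e ι) : realNorm (c • u) = |c| * realNorm u := by
  rw [realNorm, l2norm_smul, ENNReal.toReal_mul, toReal_enorm, Real.norm_eq_abs, realNorm]

theorem realNorm_le_of_l2norm_le {u : L2e ι} {v : L2e κ} {c : ℝ} (hc : 0 ≤ c) (hv : InL2 v)
    (h : l2norm u ≤ ENNReal.ofReal c * l2norm v) : InL2 u ∧ realNorm u ≤ c * realNorm v := by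
  have htop : ENNReal.ofReal c * l2norm v < ∞ :=
    ENNReal.mul_lt_top ENNReal.ofReal_lt_top (inL2_iff.1 hv)
  refine ⟨inL2_iff.2 (h.trans_lt htop), ?_⟩
  have h1 := ENNReal.toReal_mono htop.ne h
  rwa [ENNReal.toReal_mul, ENNReal.toReal_ofReal hc] at h1

/-- A system with finite gain which maps `0` to `0` is bounded on `L_2`. -/
theorem exists_bound_of_gain {H : L2e ι → L2e κ} (h0 : H 0 = 0) (hg : gain H < ∞) :
    ∃ c : ℝ, 0 ≤ c ∧ ∀ u, InL2 u → InL2 (H u) ∧ realNorm (H u) ≤ c * realNorm u := by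
  refine ⟨(gain H).toReal, ENNReal.toReal_nonneg, fun u hu => ?_⟩
  refine realNorm_le_of_l2norm_le ENNReal.toReal_nonneg hu ?_
  rw [ENNReal.ofReal_toReal hg.ne]
  -- The supremum defining the gain omits `u = 0`; there `H 0 = 0` takes over.
  by_cases hu0 : u = 0
  · rw [hu0, h0, l2norm_zero]
    exact zero_le
  · rw [← ENNReal.div_le_iff (l2norm_ne_zero hu0) (inL2_iff.1 hu).ne]
    exact le_iSup_of_le u (le_iSup_of_le hu (le_iSup_of_le hu0 le_rfl))

theorem IsBoundedCausalLTI.map_zero {H : L2e ι → L2e κ} (h : IsBoundedCausalLTI H) : H 0 = 0 := by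
  simpa using h.map_smul 0 0

theorem IsBoundedCausalLTI.map_sub {H : L2e ι → L2e κ} (h : IsBoundedCausalLTI H) (u v : L2e ι) :
    H (u - v) = H u - H v := by
  refine eq_sub_of_add_eq (G := L2e κ) ?_
  rw [← h.map_add]
  exact congrArg H (sub_add_cancel (G := L2e ι) u v)

theorem IsBoundedCausalLTI.exists_bound {H : L2e ι → L2e κ} (h : IsBoundedCausalLTI H) :
    ∃ c : ℝ, 0 ≤ c ∧ ∀ u, InL2 u → InL2 (H u) ∧ realNorm (H u) ≤ c * realNorm u := by
  refine exists_bound_of_gain h.map_zero (lt_of_le_of_lt ?_ h.bounded)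
  refine iSup_le fun u => iSup_le fun hu => iSup_le fun hu0 => ?_
  refine le_iSup_of_le u (le_iSup_of_le 0 (le_iSup_of_le hu (le_iSup_of_le inL2_zero
    (le_iSup_of_le hu0 ?_))))
  rw [h.map_zero, L2e_sub_zero, L2e_sub_zero]

theorem incGain_lt_top_of_bound {H : L2e ι → L2e κ} {c : ℝ}
    (h : ∀ u v, InL2 u → InL2 v → InL2 (H u - H v) ∧ realNorm (H u - H v) ≤ c * realNorm (u - v)) :
    incGain H < ∞ := by
  refine lt_of_le_of_lt (b := ENNReal.ofReal c) ?_ ENNReal.ofReal_lt_top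
  refine iSup_le fun u => iSup_le fun v => iSup_le fun hu => iSup_le fun hv =>
    iSup_le fun _ => ENNReal.div_le_of_le_mul ?_
  obtain ⟨h1, h2⟩ := h u v hu hv
  rw [← h1.ofReal_realNorm, ← (hu.sub hv).ofReal_realNorm,
    ← ENNReal.ofReal_mul' (realNorm_nonneg _)]
  exact ENNReal.ofReal_le_ofReal h2

/-! ### Truncations -/

theorem trunc_coeFn (T : ℝ) (u : L2e ι) :
    (trunc T u).val =ᵐ[timeMeasure] (Iic T).indicator u.val := AEEqFun.coeFn_mk _ _

theorem trunc_add (T : ℝ) (u v : L2e ι) : trunc T (u + v) = trunc T u + trunc T v := by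
  refine Subtype.ext (AEEqFun.ext ?_)
  filter_upwards [trunc_coeFn T (u + v), trunc_coeFn T u, trunc_coeFn T v,
    AEEqFun.coeFn_add u.val v.val, AEEqFun.coeFn_add (trunc T u).val (trunc T v).val]
    with t h1 h2 h3 h4 h5
  rw [h1, Submodule.coe_add (trunc T u), h5, Pi.add_apply, h2, h3]
  by_cases h : t ∈ Iic T
  · simp only [indicator_of_mem h, Submodule.coe_add, h4, Pi.add_apply]
  · simp only [indicator_of_notMem h, add_zero]

theorem trunc_smul (T c : ℝ) (u : L2e ι) : trunc T (c • u) = c • trunc T u := by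
  refine Subtype.ext (AEEqFun.ext ?_)
  filter_upwards [trunc_coeFn T (c • u), trunc_coeFn T u,
    AEEqFun.coeFn_smul c u.val, AEEqFun.coeFn_smul c (trunc T u).val] with t h1 h2 h3 h4
  rw [h1, Submodule.coe_smul c (trunc T u), h4, Pi.smul_apply, h2]
  by_cases h : t ∈ Iic T
  · simp only [indicator_of_mem h, Submodule.coe_smul, h3, Pi.smul_apply]
  · simp only [indicator_of_notMem h, smul_zero]

theorem inL2_trunc {T : ℝ} (hT : 0 ≤ T) (u : L2e ι) : InL2 (trunc T u) := u.2 T hT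

theorem l2norm_trunc_le (T : ℝ) (u : L2e ι) : l2norm (trunc T u) ≤ l2norm u := by
  rw [l2norm, eLpNorm_congr_ae (trunc_coeFn T u)]
  exact eLpNorm_indicator_le _

theorem realNorm_trunc_le (T : ℝ) {u : L2e ι} (hu : InL2 u) :
    realNorm (trunc T u) ≤ realNorm u :=
  ENNReal.toReal_mono (inL2_iff.1 hu).ne (l2norm_trunc_le T u)

/-- A signal whose truncations have uniformly bounded norm lies in `L_2`. -/
theorem inL2_of_trunc_le {u : L2e ι} {B : ℝ} (h : ∀ T, 0 ≤ T → realNorm (trunc T u) ≤ B) :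
    InL2 u := by
  have hn : ∀ k : ℕ, eLpNorm ((Iic (k : ℝ)).indicator u.val) 2 timeMeasure ≤ ENNReal.ofReal B := by
    intro k
    rw [← eLpNorm_congr_ae (trunc_coeFn (k : ℝ) u)]
    change l2norm _ ≤ _
    rw [← (inL2_trunc k.cast_nonneg u).ofReal_realNorm]
    exact ENNReal.ofReal_le_ofReal (h k k.cast_nonneg)
  have hlim : ∀ᵐ t ∂timeMeasure, Filter.Tendsto
      (fun k : ℕ => (Iic (k : ℝ)).indicator u.val t) Filter.atTop (nhds (u.val t)) := by
    refine Filter.Eventually.of_forall fun t => tendsto_const_nhds.congr' ?_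
    obtain ⟨k₀, hk₀⟩ := exists_nat_ge t
    filter_upwards [Filter.eventually_ge_atTop k₀] with k hk
    have : t ∈ Iic (k : ℝ) := hk₀.trans (by exact_mod_cast hk)
    rw [indicator_of_mem this]
  -- The truncations to `[0, k]` are pointwise eventually equal to `u`, so Fatou bounds its norm by
  -- `B`.
  have hfatou := Lp.eLpNorm_lim_le_liminf_eLpNorm (p := 2)
    (fun k : ℕ => u.val.aestronglyMeasurable.indicator (measurableSet_Iic (a := (k : ℝ))))
    u.val hlim
  refine inL2_iff.2 (lt_of_le_of_lt hfatou ?_)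
  refine lt_of_le_of_lt (b := ENNReal.ofReal B) ?_ ENNReal.ofReal_lt_top
  exact Filter.liminf_le_of_le (by isBoundedDefault) fun b hb =>
    let ⟨k, hk⟩ := hb.exists
    hk.trans (hn k)

/-- The bound of a causal system carries over to truncated signals. -/
theorem IsCausal.realNorm_trunc_le {H : L2e ι → L2e κ} (hH : IsCausal H) {c : ℝ}
    (hc : ∀ u, InL2 u → InL2 (H u) ∧ realNorm (H u) ≤ c * realNorm u) {T : ℝ} (hT : 0 ≤ T)
    (u : L2e ι) : realNorm (trunc T (H u)) ≤ c * realNorm (trunc T u) := by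
  rw [hH T hT u]
  obtain ⟨h1, h2⟩ := hc _ (inL2_trunc hT u)
  exact (Lure.realNorm_trunc_le T h1).trans h2

/-! ### The a priori estimate -/

/-- Expansion of the form, with every term involving `q` bounded by Cauchy–Schwarz and the operator
norm. -/
theorem quadForm_sub_le (M : Matrix κ κ ℝ) (p q : EuclideanSpace ℂ κ) :
    quadForm M (p - q) ≤ quadForm M p +
      ‖matrixCLM (M.map Complex.ofReal)‖ * (2 * (‖p‖ * ‖q‖) + ‖q‖ ^ 2) := by
  set L := matrixCLM (M.map Complex.ofReal) with hL
  have hb : ∀ x y : EuclideanSpace ℂ κ, |(inner ℂ x (L y)).re| ≤ ‖L‖ * (‖x‖ * ‖y‖) := fun x y =>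
    calc |(inner ℂ x (L y)).re| ≤ ‖inner ℂ x (L y)‖ := Complex.abs_re_le_norm _
      _ ≤ ‖x‖ * ‖L y‖ := norm_inner_le_norm _ _
      _ ≤ ‖x‖ * (‖L‖ * ‖y‖) := by gcongr; exact L.le_opNorm y
      _ = ‖L‖ * (‖x‖ * ‖y‖) := by ring
  have h1 := (abs_le.1 (hb p q)).1
  have h2 := (abs_le.1 (hb q p)).1
  have h3 := (abs_le.1 (hb q q)).2
  have he : quadForm M (p - q) = quadForm M p - (inner ℂ p (L q)).re - (inner ℂ q (L p)).re +
      (inner ℂ q (L q)).re := by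
    simp only [quadForm, ← hL, map_sub, inner_sub_left, inner_sub_right, Complex.sub_re]
    ring
  rw [he]
  linarith

/-- Perturbation of a uniformly strict frequency-domain inequality. -/
theorem exists_quadForm_perturb_le {n m : ℕ} {M : Matrix (Fin m) (Fin m) ℝ}
    {Nω : ℝ → Matrix (Fin m) (Fin 2 × Fin n) ℂ} {A : ℝ → Matrix (Fin n) (Fin n) ℂ}
    (hA : ∃ c : ℝ, ∀ ω i j, ‖A ω i j‖ ≤ c) (hN : ∃ c : ℝ, ∀ ω i j, ‖Nω ω i j‖ ≤ c)
    {ε : ℝ} (hε : 0 < ε) (h : ∀ ω (v : EuclideanSpace ℂ (Fin n)),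
      quadForm M (matrixCLM (Nω ω) (complexBlock 0 (matrixCLM (A ω) v) + complexBlock 1 v)) ≤
        -(ε * ‖v‖ ^ 2)) :
    ∃ D : ℝ, 0 ≤ D ∧ ∀ ω (a d : EuclideanSpace ℂ (Fin n)),
      quadForm M (matrixCLM (Nω ω)
        (complexBlock 0 (matrixCLM (A ω) a) + complexBlock 1 (a - d))) ≤
        -(ε / 2 * ‖a‖ ^ 2) + D * ‖d‖ ^ 2 := by
  obtain ⟨c, hc⟩ := hA
  obtain ⟨c', hc'⟩ := hN
  set cA : ℝ := |Fintype.card (Fin n) * (Fintype.card (Fin n) * c)|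
  set cN : ℝ := |Fintype.card (Fin m) * (Fintype.card (Fin 2 × Fin n) * c')|
  have hcA : ∀ ω v, ‖matrixCLM (A ω) v‖ ≤ cA * ‖v‖ := fun ω v =>
    (norm_matrixCLM_le (hc ω) v).trans (by gcongr; exact le_abs_self _)
  have hcN : ∀ ω v, ‖matrixCLM (Nω ω) v‖ ≤ cN * ‖v‖ := fun ω v =>
    (norm_matrixCLM_le (hc' ω) v).trans (by gcongr; exact le_abs_self _)
  have hcA0 : 0 ≤ cA := abs_nonneg _
  have hcN0 : 0 ≤ cN := abs_nonneg _
  set b₀ : ℝ := ‖(complexBlock 0 : EuclideanSpace ℂ (Fin n) →L[ℂ] _)‖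
  set b₁ : ℝ := ‖(complexBlock 1 : EuclideanSpace ℂ (Fin n) →L[ℂ] _)‖
  set L : ℝ := ‖matrixCLM (M.map Complex.ofReal)‖
  have hb₀ : 0 ≤ b₀ := norm_nonneg _
  have hb₁ : 0 ≤ b₁ := norm_nonneg _
  have hL : 0 ≤ L := norm_nonneg _
  set cp : ℝ := cN * (b₀ * cA + b₁)
  set cq : ℝ := cN * b₁
  have hcp : 0 ≤ cp := by positivity
  have hcq : 0 ≤ cq := by positivity
  set k : ℝ := L * cp * cq
  -- The cross term is at most `2k‖a‖‖d‖`. Young's inequality spends `ε / 2` of the margin on it and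
  -- leaves `2k²/ε` on `‖d‖²`; the other summand comes from the term in `‖q‖²`.
  refine ⟨2 * k ^ 2 / ε + L * cq ^ 2, by positivity, fun ω a d => ?_⟩
  set p := matrixCLM (Nω ω) (complexBlock 0 (matrixCLM (A ω) a) + complexBlock 1 a)
  set q := matrixCLM (Nω ω) (complexBlock 1 d)
  have hsplit : matrixCLM (Nω ω)
      (complexBlock 0 (matrixCLM (A ω) a) + complexBlock 1 (a - d)) = p - q := by
    simp only [p, q, ← map_sub]
    congr 1
    rw [map_sub]
    abel
  have hp : ‖p‖ ≤ cp * ‖a‖ :=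
    calc ‖p‖ ≤ cN * ‖complexBlock 0 (matrixCLM (A ω) a) + complexBlock 1 a‖ := hcN _ _
      _ ≤ cN * (b₀ * (cA * ‖a‖) + b₁ * ‖a‖) := by
        gcongr
        refine (norm_add_le _ _).trans (add_le_add ?_ (ContinuousLinearMap.le_opNorm _ _))
        refine (ContinuousLinearMap.le_opNorm _ _).trans ?_
        gcongr
        exact hcA ω a
      _ = cp * ‖a‖ := by simp only [cp]; ring
  have hq : ‖q‖ ≤ cq * ‖d‖ :=
    calc ‖q‖ ≤ cN * ‖complexBlock 1 d‖ := hcN _ _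
      _ ≤ cN * (b₁ * ‖d‖) := by gcongr; exact ContinuousLinearMap.le_opNorm _ _
      _ = cq * ‖d‖ := by simp only [cq]; ring
  rw [hsplit]
  have h1 := quadForm_sub_le M p q
  have h2 : L * (2 * (‖p‖ * ‖q‖) + ‖q‖ ^ 2) ≤
      L * (2 * ((cp * ‖a‖) * (cq * ‖d‖)) + (cq * ‖d‖) ^ 2) := by gcongr
  have h3 : 2 * (k * (‖a‖ * ‖d‖)) ≤ ε / 2 * ‖a‖ ^ 2 + 2 * k ^ 2 / ε * ‖d‖ ^ 2 := by
    have h4 : 0 ≤ ε / 2 * (‖a‖ - 2 * k / ε * ‖d‖) ^ 2 := by positivity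
    have h5 : ε / 2 * (‖a‖ - 2 * k / ε * ‖d‖) ^ 2 =
        ε / 2 * ‖a‖ ^ 2 + 2 * k ^ 2 / ε * ‖d‖ ^ 2 - 2 * (k * (‖a‖ * ‖d‖)) := by
      field_simp
      ring
    linarith
  have h6 : L * (2 * ((cp * ‖a‖) * (cq * ‖d‖)) + (cq * ‖d‖) ^ 2) =
      2 * (k * (‖a‖ * ‖d‖)) + L * cq ^ 2 * ‖d‖ ^ 2 := by
    simp only [k]; ring
  have h7 := h ω a
  change quadForm M p ≤ _ at h7
  change quadForm M (p - q) ≤ quadForm M p + L * (2 * (‖p‖ * ‖q‖) + ‖q‖ ^ 2) at h1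
  have h8 : (2 * k ^ 2 / ε + L * cq ^ 2) * ‖d‖ ^ 2 =
      2 * k ^ 2 / ε * ‖d‖ ^ 2 + L * cq ^ 2 * ‖d‖ ^ 2 := by ring
  linarith

/-- The incremental a priori estimate: for solutions in `L_2`, the loop signal depends on the
external signal with a Lipschitz constant that is independent of the second system. -/
theorem exists_apriori_bound {n m : ℕ} {H₁ : L2e (Fin n) → L2e (Fin n)}
    {H₁ω : ℝ → Matrix (Fin n) (Fin n) ℂ} {M : Matrix (Fin m) (Fin m) ℝ}
    {N : L2e (Fin 2 × Fin n) → L2e (Fin m)} {Nω : ℝ → Matrix (Fin m) (Fin 2 × Fin n) ℂ}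
    (hH₁ : IsBoundedCausalLTI H₁) (hH₁ω : IsFrequencyResponse H₁ H₁ω)
    (hN : IsBoundedCausalLTI N) (hNω : IsFrequencyResponse N Nω) {r : ℝ} (hr : 0 < r)
    (hd : ∀ ω, ENNReal.ofReal r ≤ setDist (matrixSRG (H₁ω ω)) (regionC M Nω)) :
    ∃ C : ℝ, 1 ≤ C ∧ ∀ H : L2e (Fin n) → L2e (Fin n), SoftIQC M N H →
      ∀ u u' : L2e (Fin n), InL2 u → InL2 u' → InL2 (H (H₁ u)) → InL2 (H (H₁ u')) →
        realNorm (u - u') ≤ C * realNorm ((u - H (H₁ u)) - (u' - H (H₁ u'))) := by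
  obtain ⟨ε, hε, hstrict⟩ := exists_quadForm_le hH₁ω.bounded hr hd
  obtain ⟨D, hD, hpert⟩ := exists_quadForm_perturb_le hH₁ω.bounded hNω.bounded hε hstrict
  obtain ⟨c₁, -, hc₁⟩ := hH₁.exists_bound
  obtain ⟨c₂, -, hc₂⟩ := hN.exists_bound
  -- The estimate yields `‖Δu‖² ≤ (2D/ε) ‖Δw‖²`. Since `q ≤ (q + 1)²` for `q ≥ 0`, adding `1` avoids
  -- a square root; it also gives `C ≥ 1`, as the identity loop at `μ = 0` requires.
  refine ⟨2 * D / ε + 1, le_add_of_nonneg_left (by positivity), ?_⟩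
  intro H hH u u' hu hu' hy hy'
  have hiqc := hH (H₁ u) (H₁ u') (hc₁ u hu).1 hy (hc₁ u' hu').1 hy'
  rw [← hH₁.map_sub] at hiqc
  set Δw := (u - H (H₁ u)) - (u' - H (H₁ u'))
  set Δy := H (H₁ u) - H (H₁ u')
  have hΔy : InL2 Δy := hy.sub hy'
  have hΔw : InL2 Δw := (hu.sub hy).sub (hu'.sub hy')
  have hsum : u - u' = Δw + Δy := by simp only [Δw, Δy]; abel
  have hΔu : InL2 (u - u') := hu.sub hu'
  have hH₁u : InL2 (H₁ (u - u')) := (hc₁ _ hΔu).1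
  have hg : InL2 (N (stack (H₁ (u - u')) Δy)) := (hc₂ _ (hH₁u.stack hΔy)).1
  rw [← integral_quadForm_signalFourier M hg] at hiqc
  have hadd : signalFourier hΔu = signalFourier hΔw + signalFourier hΔy := by
    have := signalFourier_add hΔw hΔy (hΔw.add hΔy)
    rw [← this]
    congr 1
  have hle : ∀ᵐ ξ, quadForm M (signalFourier hg ξ) ≤
      -(ε / 2) * ‖signalFourier hΔu ξ‖ ^ 2 + D * ‖signalFourier hΔw ξ‖ ^ 2 := by
    filter_upwards [ae_signalFourier_eq hNω (hH₁u.stack hΔy) hg, signalFourier_stack hH₁u hΔy,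
      ae_signalFourier_eq hH₁ω hΔu hH₁u,
      Lp.coeFn_add (signalFourier hΔw) (signalFourier hΔy)] with ξ h1 h2 h3 h4
    rw [← hadd, Pi.add_apply] at h4
    have h5 : signalFourier hΔy ξ = signalFourier hΔu ξ - signalFourier hΔw ξ := by
      rw [h4]; abel
    -- At each frequency the pair is `(A a, a - d)` with `a`, `d` the transforms of `Δu`, `Δw`.
    rw [h1, h2, h3, h5, neg_mul]
    exact hpert _ _ _
  have hint := integral_mono_ae (integrable_quadForm M (signalFourier hg))
    (((integrable_norm_sq (signalFourier hΔu)).const_mul (-(ε / 2))).add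
      ((integrable_norm_sq (signalFourier hΔw)).const_mul D)) hle
  simp only [Pi.add_apply] at hint
  rw [integral_add ((integrable_norm_sq _).const_mul _) ((integrable_norm_sq _).const_mul _),
    integral_const_mul, integral_const_mul, integral_norm_sq_signalFourier,
    integral_norm_sq_signalFourier] at hint
  change _ ≤ -(ε / 2) * realNorm (u - u') ^ 2 + D * realNorm Δw ^ 2 at hint
  have hΔw0 := realNorm_nonneg Δw
  have hq : 0 ≤ 2 * D / ε := by positivity
  refine (sq_le_sq₀ (realNorm_nonneg _) (by positivity)).1 ?_
  have h1 : realNorm (u - u') ^ 2 ≤ 2 * D / ε * realNorm Δw ^ 2 := by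
    have : ε / 2 * realNorm (u - u') ^ 2 ≤ ε / 2 * (2 * D / ε * realNorm Δw ^ 2) := by
      have e : ε / 2 * (2 * D / ε * realNorm Δw ^ 2) = D * realNorm Δw ^ 2 := by field_simp
      rw [e]
      linarith
    exact le_of_mul_le_mul_left this (by positivity)
  refine h1.trans ?_
  rw [mul_pow]
  gcongr
  nlinarith

/-! ### Continuation in the feedback gain -/

/-- If the loop with gain `μ` is stable with bound `C`, every solution of the loop with a nearby
gain `μ'` and external signal in `L_2` lies in `L_2`. -/
theorem inL2_of_nearby_loop {ι : Type} [Fintype ι] {H₁ H₂ F : L2e ι → L2e ι} {μ μ' c₁ c₂ C : ℝ}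
    (hc₂0 : 0 ≤ c₂) (hC : 0 ≤ C)
    (hH₁ : IsCausal H₁) (hH₂ : IsCausal H₂) (hF : IsCausal F)
    (hc₁ : ∀ u, InL2 u → InL2 (H₁ u) ∧ realNorm (H₁ u) ≤ c₁ * realNorm u)
    (hc₂ : ∀ u, InL2 u → InL2 (H₂ u) ∧ realNorm (H₂ u) ≤ c₂ * realNorm u)
    (hFC : ∀ w, InL2 w → InL2 (F w) ∧ realNorm (F w) ≤ C * realNorm w)
    (hleft : Function.LeftInverse F fun u => u - μ • H₂ (H₁ u))
    (hsmall : C * (|μ' - μ| * (c₂ * c₁)) ≤ 1 / 2) {u : L2e ι}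
    (hw : InL2 (u - μ' • H₂ (H₁ u))) : InL2 u := by
  set w := u - μ' • H₂ (H₁ u)
  -- The loop with gain `μ'` is the loop with gain `μ` driven by an additional external signal of
  -- size `|μ' - μ|`.
  have hv : u - μ • H₂ (H₁ u) = w + (μ' - μ) • H₂ (H₁ u) := by
    simp only [w]
    module
  -- Truncated norms are finite for every signal in `L_{2e}`, so the small-gain inequality `X ≤ C‖w‖
  -- + X / 2` can be solved for `X`; causality makes the bounds hold for truncations.
  refine inL2_of_trunc_le (B := 2 * (C * realNorm w)) fun T hT => ?_
  set X := realNorm (trunc T u)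
  have hX : 0 ≤ X := realNorm_nonneg _
  have h1 : realNorm (trunc T (H₂ (H₁ u))) ≤ c₂ * c₁ * X :=
    calc _ ≤ c₂ * realNorm (trunc T (H₁ u)) := hH₂.realNorm_trunc_le hc₂ hT _
      _ ≤ c₂ * (c₁ * X) := by gcongr; exact hH₁.realNorm_trunc_le hc₁ hT _
      _ = c₂ * c₁ * X := by ring
  have h2 : X ≤ C * realNorm (trunc T (w + (μ' - μ) • H₂ (H₁ u))) := by
    have := hF.realNorm_trunc_le hFC hT (u - μ • H₂ (H₁ u))
    rwa [show F (u - μ • H₂ (H₁ u)) = u from hleft u, hv] at this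
  have h3 : realNorm (trunc T (w + (μ' - μ) • H₂ (H₁ u))) ≤
      realNorm w + |μ' - μ| * (c₂ * c₁ * X) := by
    rw [trunc_add, trunc_smul]
    refine (realNorm_add_le (inL2_trunc hT _) ((inL2_trunc hT _).smul _)).trans ?_
    rw [realNorm_smul]
    exact add_le_add (realNorm_trunc_le T hw) (by gcongr)
  have h4 : X ≤ C * (realNorm w + |μ' - μ| * (c₂ * c₁ * X)) := h2.trans (by gcongr)
  have h5 : C * (|μ' - μ| * (c₂ * c₁)) * X ≤ 1 / 2 * X := by gcongr
  have h6 : C * (realNorm w + |μ' - μ| * (c₂ * c₁ * X)) =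
      C * realNorm w + C * (|μ' - μ| * (c₂ * c₁)) * X := by ring
  linarith

/-- The loop with gain `μ` has a causal inverse which is bounded by `C` on `L_2`. -/
def StableLoop {ι : Type} [Fintype ι] (H₁ H₂ : L2e ι → L2e ι) (C μ : ℝ) : Prop :=
  ∃ F : L2e ι → L2e ι, IsCausal F ∧
    Function.LeftInverse F (fun u => u - μ • H₂ (H₁ u)) ∧
    Function.RightInverse F (fun u => u - μ • H₂ (H₁ u)) ∧
    ∀ w, InL2 w → InL2 (F w) ∧ realNorm (F w) ≤ C * realNorm w

theorem trunc_trunc {ι : Type} [Fintype ι] (T : ℝ) (u : L2e ι) :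
    trunc T (trunc T u) = trunc T u := by
  refine Subtype.ext (AEEqFun.ext ?_)
  filter_upwards [trunc_coeFn T (trunc T u), trunc_coeFn T u] with t h1 h2
  rw [h1]
  by_cases h : t ∈ Iic T
  · rw [indicator_of_mem h]
  · rw [h2, indicator_of_notMem h, indicator_of_notMem h]

theorem stableLoop_zero {ι : Type} [Fintype ι] (H₁ H₂ : L2e ι → L2e ι) {C : ℝ} (hC : 1 ≤ C) :
    StableLoop H₁ H₂ C 0 :=
  ⟨id, fun T _ u => (trunc_trunc T u).symm, fun u => by simp [L2e_sub_zero],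
    fun u => by simp [L2e_sub_zero],
    fun w hw => ⟨hw, le_mul_of_one_le_left (realNorm_nonneg w) hC⟩⟩

/-- The continuation argument: a uniform a priori bound makes the loop with gain `1`
stable. -/
theorem stableLoop_one {n : ℕ} {H₁ H₂ : L2e (Fin n) → L2e (Fin n)} {c₁ c₂ C : ℝ}
    (hc₁0 : 0 ≤ c₁) (hc₂0 : 0 ≤ c₂) (hC : 1 ≤ C)
    (hH₁ : IsCausal H₁) (hH₂ : IsCausal H₂)
    (hc₁ : ∀ u, InL2 u → InL2 (H₁ u) ∧ realNorm (H₁ u) ≤ c₁ * realNorm u)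
    (hc₂ : ∀ u, InL2 u → InL2 (H₂ u) ∧ realNorm (H₂ u) ≤ c₂ * realNorm u)
    (hwp : ∀ μ : ℝ, 0 < μ → μ ≤ 1 → WellPosed H₁ (fun u => μ • H₂ u))
    (hap : ∀ μ : ℝ, 0 < μ → μ ≤ 1 → ∀ u, InL2 u →
      realNorm u ≤ C * realNorm (u - μ • H₂ (H₁ u))) :
    StableLoop H₁ H₂ C 1 := by
  -- Steps of length `1 / K` with `K ≥ 2 C c₂ c₁` meet the smallness condition; the extra `1` makes
  -- `K` positive.
  obtain ⟨K, hK⟩ := exists_nat_ge (2 * (C * (c₂ * c₁)) + 1)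
  have hK0 : (0 : ℝ) < K := lt_of_lt_of_le (by positivity) hK
  have key : ∀ j : ℕ, j ≤ K → StableLoop H₁ H₂ C (j / K) := by
    intro j
    induction j with
    | zero =>
      intro _
      simpa using stableLoop_zero H₁ H₂ hC
    | succ j ih =>
      intro hj
      obtain ⟨F, hF, hleft, -, hFC⟩ := ih (by omega)
      have hμ0 : (0 : ℝ) < ((j + 1 : ℕ) : ℝ) / K := by positivity
      have hμ1 : ((j + 1 : ℕ) : ℝ) / K ≤ 1 := by
        rw [div_le_one hK0]
        exact_mod_cast hj
      have hstep : |((j + 1 : ℕ) : ℝ) / K - j / K| = 1 / K := by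
        rw [← sub_div, Nat.cast_succ, add_sub_cancel_left, abs_of_pos (by positivity)]
      have hsmall : C * (|((j + 1 : ℕ) : ℝ) / K - j / K| * (c₂ * c₁)) ≤ 1 / 2 := by
        rw [hstep]
        have : C * (1 / K * (c₂ * c₁)) = C * (c₂ * c₁) / K := by ring
        rw [this, div_le_iff₀ hK0]
        linarith
      -- Well-posedness supplies the inverse; the induction provides its boundedness. The a priori
      -- bound restores the same `C` at each gain, so the step length never shrinks.
      obtain ⟨F', hF', hleft', hright'⟩ := hwp _ hμ0 hμ1
      refine ⟨F', hF', hleft', hright', fun w hw => ?_⟩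
      have hFw : F' w - (((j + 1 : ℕ) : ℝ) / K) • H₂ (H₁ (F' w)) = w := hright' w
      have hin : InL2 (F' w) := inL2_of_nearby_loop hc₂0 (zero_le_one.trans hC) hH₁ hH₂ hF
        hc₁ hc₂ hFC hleft hsmall (by rw [hFw]; exact hw)
      refine ⟨hin, ?_⟩
      have := hap _ hμ0 hμ1 (F' w) hin
      rwa [hFw] at this
  simpa [div_self hK0.ne'] using key K le_rfl

end Lure

end

/-! ### The closed loop at gain `1` -/

open Lure in
theorem mainTheorem4 (n m : ℕ)
    (H₁ H₂ : L2e (Fin n) → L2e (Fin n)) (H₁ω : ℝ → Matrix (Fin n) (Fin n) ℂ)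
    (M : Matrix (Fin m) (Fin m) ℝ)
    (N : L2e (Fin 2 × Fin n) → L2e (Fin m)) (Nω : ℝ → Matrix (Fin m) (Fin 2 × Fin n) ℂ)
    (hH₁ : IsBoundedCausalLTI H₁) (hH₁ω : IsFrequencyResponse H₁ H₁ω)
    (hH₂zero : H₂ 0 = 0) (hH₂causal : IsCausal H₂) (hH₂gain : gain H₂ < ∞)
    (hM : M.IsSymm)
    (hN : IsBoundedCausalLTI N) (hNω : IsFrequencyResponse N Nω)
    (hwp : ∀ μ : ℝ, 0 < μ → μ ≤ 1 → WellPosed H₁ (fun u => μ • H₂ u))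
    (hIQC : ∀ μ : ℝ, 0 < μ → μ ≤ 1 → SoftIQC M N (fun u => μ • H₂ u))
    (hdist : ∃ r : ℝ, 0 < r ∧ ∀ μ : ℝ, 0 < μ → μ ≤ 1 → ∀ ω : ℝ,
      ENNReal.ofReal r ≤ setDist (matrixSRG (H₁ω ω)) (μ • regionC M Nω)) :
    ∃ T : L2e (Fin n) → L2e (Fin n), IsClosedLoopMap H₁ H₂ T ∧ incGain T < ∞ := by
  obtain ⟨r, hr, hdist⟩ := hdist
  -- Every `μ H₂` obeys the IQC with the same multipliers, so the unscaled region governs the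
  -- estimate at each gain.
  have hd : ∀ ω, ENNReal.ofReal r ≤ setDist (matrixSRG (H₁ω ω)) (regionC M Nω) := fun ω => by
    simpa using hdist 1 one_pos le_rfl ω
  obtain ⟨C, hC, hap⟩ := exists_apriori_bound hH₁ hH₁ω hN hNω hr hd
  obtain ⟨c₁, hc₁0, hc₁⟩ := hH₁.exists_bound
  obtain ⟨c₂, hc₂0, hc₂⟩ := exists_bound_of_gain hH₂zero hH₂gain
  have hloop : ∀ (μ : ℝ) (u : L2e (Fin n)), InL2 u → InL2 (μ • H₂ (H₁ u)) := fun μ u hu =>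
    (hc₂ _ (hc₁ u hu).1).1.smul μ
  have hap0 : ∀ μ : ℝ, 0 < μ → μ ≤ 1 → ∀ u, InL2 u →
      realNorm u ≤ C * realNorm (u - μ • H₂ (H₁ u)) := fun μ h0 h1 u hu => by
    -- Comparison with the zero solution turns the incremental estimate into the plain bound used in
    -- the continuation.
    have h := hap _ (hIQC μ h0 h1) u 0 hu inL2_zero (hloop μ u hu) (hloop μ 0 inL2_zero)
    simpa [hH₁.map_zero, hH₂zero, L2e_sub_zero] using h
  obtain ⟨F, -, hleft, hright, hFC⟩ :=
    stableLoop_one hc₁0 hc₂0 hC hH₁.causal hH₂causal hc₁ hc₂ hwp hap0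
  have hFw : ∀ w, F w - H₂ (H₁ (F w)) = w := fun w => by simpa using hright w
  have hFu : ∀ u, F (u - H₂ (H₁ u)) = u := fun u => by simpa using hleft u
  refine ⟨fun w => H₁ (F w), fun w y₁ => ⟨?_, ?_⟩, ?_⟩
  · rintro rfl
    exact ⟨F w, H₁ (F w), H₂ (H₁ (F w)), (sub_eq_iff_eq_add (G := L2e (Fin n))).1 (hFw w), rfl, rfl, rfl⟩
  · rintro ⟨u₁, u₂, y₂, hu₁, rfl, rfl, rfl⟩
    have : w = u₁ - H₂ (H₁ u₁) := eq_sub_of_add_eq (G := L2e (Fin n)) hu₁.symm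
    rw [this]
    exact congrArg H₁ (hFu u₁)
  -- `C` bounds the increment of `u₁` and `c₁` the passage from `u₁` to `y₁ = H₁ u₁`.
  · refine incGain_lt_top_of_bound (c := c₁ * C) fun w v hw hv => ?_
    have hFwin := (hFC w hw).1
    have hFvin := (hFC v hv).1
    have h := hap _ (hIQC 1 one_pos le_rfl) (F w) (F v) hFwin hFvin
      (hloop 1 _ hFwin) (hloop 1 _ hFvin)
    simp only [one_smul, hFw] at h
    obtain ⟨h1, h2⟩ := hc₁ _ (hFwin.sub hFvin)
    rw [← hH₁.map_sub, mul_assoc]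
    exact ⟨h1, h2.trans (by gcongr)⟩
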